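/- All graphs are finite. Let $V_k(H)$ denote the set of vertices of degree $k$ in a graph $H$. Let $\mathcal{H}$ be the set of all connected simple graphs $H$ such that every vertex of $H$ has degree $2$ or $3$; every cycle $C$ of $H$ is separating, i.e. the graph $H \setminus E(C)$ obtained by deleting the edges of $C$ is disconnected; $V_2(H)$ is a stable set; and every vertex in $V_3(H)$ has exactly one neighbour in $V_2(H)$. For $H \in \mathcal{H}$, the cycles of $H - V_2(H)$ are called the basic cycles of $H$; they are pairwise vertex-disjoint and cover $V_3(H)$. A vertex $u \in V_2(H)$ is a connector, and joins the basic cycles $C$ and $C'$, if $C \neq C'$ and one of the two neighbours of $u$ lies in $C$ and the other in $C'$. A collection $\mathcal{C}$ of connectors is simple if no two distinct members of $\mathcal{C}$ join the same pair of basic cycles. Its underlying basic-cycles graph $\tilde{H}_{\mathcal{C}}$ has all the basic cycles of $H$ as vertices, two of them being adjacent when some connector in $\mathcal{C}$ joins them. A $2$-decomposition $(F, M)$ of $H$ is a partition of $E(H)$ into the edge sets of a spanning forest $F$ and of a matching $M$. A vertex is full in $(F,M)$ if every edge of $H$ incident to it belongs to $F$. Proposition. Let $H \in \mathcal{H}$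 and let $\mathcal{C}$ be a simple collection of connectors of $H$. If $\tilde{H}_{\mathcal{C}}$ is a forest, then $H$ admits a $2$-decomposition $(F,M)$ such that 1. $|M \cap E(C)| = 1$ for every basic cycle $C$ of $H$; and 2. each $u \in \mathcal{C}$ is full in $(F,M)$ or is adjacent to a vertex that is full in $(F,M)$. In particular, $H$ admits a $2$-decomposition satisfying 2. -/

import Mathlib

namespace TwoDecomposition

universe u

/-- The set of vertices of degree `k` of a finite graph. -/
def degSet {V : Type u} [Fintype V] (G : SimpleGraph V) [DecidableRel G.Adj] (k : ℕ) : Set V :=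
  {v | G.degree v = k}

/-- A cycle of `G` (given as a closed walk) is separating if removing its edges disconnects `G`. -/
def IsSeparating {V : Type u} (G : SimpleGraph V) {v : V} (c : G.Walk v v) : Prop :=
  ¬ (G.deleteEdges {e | e ∈ c.edges}).Connected

/-- Connected graphs with minimum degree at least `p` and maximum degree at most `q` in which
every cycle is separating. -/
structure IsSepCycleGraph {V : Type u} [Fintype V] (G : SimpleGraph V) [DecidableRel G.Adj]
    (p q : ℕ) : Prop where
  connected : G.Connected
  separating : ∀ (v : V) (c : G.Walk v v), c.IsCycle → IsSeparating G c
  le_degree : ∀ v, p ≤ G.degree v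
  degree_le : ∀ v, G.degree v ≤ q

/-- The class of simple graphs with degrees two and three in which every cycle is separating, the
degree-two vertices are pairwise nonadjacent, and each degree-three vertex has exactly one
neighbour of degree two. -/
structure InClassH {V : Type u} [Fintype V] (H : SimpleGraph V) [DecidableRel H.Adj] :
    Prop where
  sepCycle : IsSepCycleGraph H 2 3
  stable : H.IsIndepSet (degSet H 2)
  unique_neighbor : ∀ v ∈ degSet H 3, ∃! w, H.Adj v w ∧ w ∈ degSet H 2

/-- A subgraph of `H` is a basic cycle if it is a cycle that avoids all vertices of degree two,
that is, a cycle of the graph obtained from `H` by removing those vertices. -/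
def IsBasicCycle {V : Type u} [Fintype V] (H : SimpleGraph V) [DecidableRel H.Adj]
    (C : H.Subgraph) : Prop :=
  ∃ (v : V) (c : H.Walk v v), c.IsCycle ∧ (∀ w ∈ c.support, w ∉ degSet H 2) ∧ C = c.toSubgraph

/-- The type of basic cycles of `H`. Two basic cycles are equal when they are equal as subgraphs. -/
abbrev BasicCycle {V : Type u} [Fintype V] (H : SimpleGraph V) [DecidableRel H.Adj] : Type u :=
  {C : H.Subgraph // IsBasicCycle H C}

/-- The degree-two vertex `y` joins the distinct basic cycles `C` and `D`: one of its two
neighbours lies in `C` and the other in `D`. -/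
def Joins {V : Type u} [Fintype V] (H : SimpleGraph V) [DecidableRel H.Adj]
    (y : V) (C D : BasicCycle H) : Prop :=
  C ≠ D ∧ y ∈ degSet H 2 ∧
    ∃ x z, H.neighborSet y = {x, z} ∧ x ∈ C.1.verts ∧ z ∈ D.1.verts

/-- A connector is a degree-two vertex joining two distinct basic cycles. -/
def IsConnector {V : Type u} [Fintype V] (H : SimpleGraph V) [DecidableRel H.Adj]
    (y : V) : Prop :=
  ∃ C D : BasicCycle H, Joins H y C D

/-- Two vertices are parallel connectors if they join the same pair of basic cycles. -/
def AreParallel {V : Type u} [Fintype V] (H : SimpleGraph V) [DecidableRel H.Adj]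
    (y y' : V) : Prop :=
  ∃ C D : BasicCycle H, Joins H y C D ∧ Joins H y' C D

/-- A simple collection of connectors: a set of connectors, no two of which are parallel. -/
structure IsSimpleCollection {V : Type u} [Fintype V] (H : SimpleGraph V) [DecidableRel H.Adj]
    (S : Set V) : Prop where
  isConnector : ∀ y ∈ S, IsConnector H y
  not_parallel : ∀ y ∈ S, ∀ y' ∈ S, y ≠ y' → ¬ AreParallel H y y'

theorem Joins.symm {V : Type u} [Fintype V] {H : SimpleGraph V} [DecidableRel H.Adj]
    {y : V} {C D : BasicCycle H} (h : Joins H y C D) : Joins H y D C := by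
  obtain ⟨hne, hy, x, z, hN, hx, hz⟩ := h
  exact ⟨hne.symm, hy, z, x, by rw [hN, Set.pair_comm], hz, hx⟩

/-- The underlying basic-cycles graph of a collection `S` of connectors: its vertices are all the
basic cycles of `H`, and two of them are adjacent when some connector in `S` joins them. -/
def bcGraph {V : Type u} [Fintype V] (H : SimpleGraph V) [DecidableRel H.Adj]
    (S : Set V) : SimpleGraph (BasicCycle H) where
  Adj C D := ∃ y ∈ S, Joins H y C D
  symm := ⟨fun _ _ ⟨y, hy, h⟩ => ⟨y, hy, h.symm⟩⟩
  loopless := ⟨fun _ ⟨_, _, h⟩ => h.1 rfl⟩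

/-- A decomposition of the edge set of `G` into a spanning forest `F` and a matching `M`. -/
structure IsTwoDecomposition {V : Type u} {G : SimpleGraph V} (F M : G.Subgraph) : Prop where
  spanning : F.IsSpanning
  acyclic : F.coe.IsAcyclic
  matching : M.IsMatching
  disjoint : Disjoint F.edgeSet M.edgeSet
  union : F.edgeSet ∪ M.edgeSet = G.edgeSet

/-- A vertex is full if every edge of `G` incident to it belongs to `F`. -/
def IsFull {V : Type u} {G : SimpleGraph V} (F : G.Subgraph) (v : V) : Prop :=
  ∀ w, G.Adj v w → F.Adj v w

end TwoDecomposition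

namespace TwoDecomposition

open SimpleGraph

universe u

/-! Each basic cycle C is separating, so it has an edge ab whose ends lie in different components of
H \ E(C). Mark a and b and put ab in M. Then match a vertex y of degree two to an unmarked
neighbour, if it has one; when y lies in S, do so only if both neighbours are unmarked.

Suppose a cycle Z avoids M. Each vertex of degree two on Z is left unmatched, hence has a marked
neighbour. Parity and the choice of ab show that at most half of the ends of Z in each basic cycle
are marked (`InClassH.two_mul_card_ends_le`). Double counting then leaves exactly one marked
neighbour per vertex of degree two on Z (`InClassH.exists_unmarked`), and such a vertex is unmatched
only if it is in S. A leaf of the forest formed by these connectors contradicts parity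
(`IsSimpleCollection.not_adj`). So Z avoids degree two and contains a basic cycle with its edge ab,
a contradiction. -/

/-! ### Parity and leaves in finite graphs -/

theorem _root_.SimpleGraph.exists_reachable_odd_degree {W : Type u} [Fintype W] (G : SimpleGraph W)
    [DecidableRel G.Adj] {v : W} (hv : Odd (G.degree v)) :
    ∃ w, w ≠ v ∧ G.Reachable v w ∧ Odd (G.degree w) := by
  classical
  -- Keeping only the edges in the component of `v` confines the handshake lemma to that component.
  let R : SimpleGraph W :=
    { Adj := fun x y => G.Adj x y ∧ G.Reachable v x
      symm := ⟨fun _ _ h => ⟨h.1.symm, h.2.trans h.1.reachable⟩⟩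
      loopless := ⟨fun _ h => h.1.ne rfl⟩ }
  have hR : ∀ x, G.Reachable v x → R.degree x = G.degree x := by
    intro x hx
    rw [← card_neighborFinset_eq_degree, ← card_neighborFinset_eq_degree]
    congr 1
    ext y
    simp [R, hx]
  obtain ⟨w, hwv, hw⟩ := R.exists_ne_odd_degree_of_exists_odd_degree v
    (by rwa [hR v (Reachable.refl v)])
  have hvw : G.Reachable v w := by
    obtain ⟨y, hy⟩ := (R.degree_pos_iff_exists_adj w).mp hw.pos
    exact hy.2
  exact ⟨w, hwv, hvw, hR w hvw ▸ hw⟩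

theorem _root_.SimpleGraph.degree_inf_add_degree_sdiff {W : Type u} [Fintype W] [DecidableEq W]
    (G K : SimpleGraph W) [DecidableRel G.Adj] [DecidableRel K.Adj] (v : W) :
    (G ⊓ K).degree v + (G \ K).degree v = G.degree v := by
  simp only [← card_neighborFinset_eq_degree]
  rw [← Finset.card_union_of_disjoint]
  · congr 1
    ext y
    simp only [Finset.mem_union, mem_neighborFinset, inf_adj, sdiff_adj]
    tauto
  · rw [Finset.disjoint_left]
    intro y
    simp only [mem_neighborFinset, inf_adj, sdiff_adj]
    tauto

theorem _root_.SimpleGraph.IsCycles.even_degree {W : Type u} [Fintype W] {Z : SimpleGraph W}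
    [DecidableRel Z.Adj] (hZ : Z.IsCycles) (v : W) : Even (Z.degree v) := by
  rcases Nat.eq_zero_or_pos (Z.degree v) with h | h
  · simp [h]
  · have := hZ (v := v) ((Z.degree_pos_iff_exists_adj v).mp h)
    rw [← coe_neighborFinset, Set.ncard_coe_finset, card_neighborFinset_eq_degree] at this
    simp [this]

theorem _root_.SimpleGraph.IsAcyclic.exists_existsUnique_adj {W : Type u} [Finite W]
    {G : SimpleGraph W} (hG : G.IsAcyclic) {u v : W} (huv : G.Adj u v) : ∃ w, ∃! x, G.Adj w x := by
  classical
  have := Fintype.ofFinite W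
  have ht := hG.isTree_connectedComponent (G.connectedComponentMk u)
  have hu : u ∈ G.connectedComponentMk u := rfl
  have hv : v ∈ G.connectedComponentMk u := ConnectedComponent.sound huv.symm.reachable
  have : Nontrivial (G.connectedComponentMk u) :=
    ⟨⟨u, hu⟩, ⟨v, hv⟩, fun h => huv.ne (congrArg Subtype.val h)⟩
  obtain ⟨⟨w, hw⟩, hw1⟩ := ht.exists_vert_degree_one_of_nontrivial
  rw [degree_eq_one_iff_existsUnique_adj] at hw1
  obtain ⟨⟨x, hx⟩, hwx, hun⟩ := hw1
  refine ⟨w, x, hwx, fun y hy => ?_⟩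
  have hy' : y ∈ G.connectedComponentMk u :=
    (ConnectedComponent.sound hy.symm.reachable).trans hw
  exact congrArg Subtype.val (hun ⟨y, hy'⟩ hy)

/-! ### Basic cycles as the components covering the vertices of degree three -/

variable {V : Type u} [Fintype V] {H : SimpleGraph V} [DecidableRel H.Adj]

theorem InClassH.degree_eq (hH : InClassH H) (v : V) : H.degree v = 2 ∨ H.degree v = 3 := by
  have := hH.sepCycle.le_degree v
  have := hH.sepCycle.degree_le v
  omega

theorem InClassH.existsUnique (hH : InClassH H) {v : V} (hv : H.degree v = 3) :
    ∃! w, H.Adj v w ∧ H.degree w = 2 :=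
  hH.unique_neighbor v hv

theorem InClassH.degree_eq_three (hH : InClassH H) {v w : V} (hv : H.degree v = 2)
    (h : H.Adj v w) : H.degree w = 3 :=
  (hH.degree_eq w).resolve_left fun hw => hH.stable hv hw h.ne h

variable (H) in
/-- The graph of the edges joining two vertices of degree different from two. -/
def innerGraph : SimpleGraph V where
  Adj v w := H.Adj v w ∧ H.degree v ≠ 2 ∧ H.degree w ≠ 2
  symm := ⟨fun _ _ h => ⟨h.1.symm, h.2.2, h.2.1⟩⟩
  loopless := ⟨fun _ h => h.1.ne rfl⟩

theorem innerGraph_le : innerGraph H ≤ H := fun _ _ h => h.1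

theorem InClassH.ncard_innerGraph (hH : InClassH H) {v : V} (hv : H.degree v = 3) :
    ((innerGraph H).neighborSet v).ncard = 2 := by
  classical
  obtain ⟨w, hw, hun⟩ := hH.existsUnique hv
  have : (innerGraph H).neighborSet v = ((H.neighborFinset v).erase w : Finset V) := by
    ext x
    simp only [mem_neighborSet, innerGraph, Finset.coe_erase, coe_neighborFinset, Set.mem_sdiff,
      Set.mem_singleton_iff]
    constructor
    · rintro ⟨h1, -, h3⟩
      exact ⟨h1, by rintro rfl; exact h3 hw.2⟩
    · rintro ⟨h1, h2⟩
      exact ⟨h1, by omega, fun h3 => h2 (hun x ⟨h1, h3⟩)⟩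
  rw [this, Set.ncard_coe_finset, Finset.card_erase_of_mem (by simpa using hw.1),
    card_neighborFinset_eq_degree, hv]

theorem InClassH.isCycles_innerGraph (hH : InClassH H) : (innerGraph H).IsCycles := by
  rintro v ⟨w, hw⟩
  exact hH.ncard_innerGraph ((hH.degree_eq v).resolve_left hw.2.1)

theorem InClassH.exists_basicCycle (hH : InClassH H) {v : V} (hv : H.degree v = 3) :
    ∃ C : BasicCycle H, v ∈ C.1.verts := by
  have hne : ((innerGraph H).neighborSet v).Nonempty :=
    Set.nonempty_of_ncard_ne_zero (by rw [hH.ncard_innerGraph hv]; norm_num)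
  obtain ⟨p, hp, -⟩ := hH.isCycles_innerGraph.exists_cycle_toSubgraph_verts_eq_connectedComponentSupp
    (ConnectedComponent.connectedComponentMk_mem (v := v)) hne
  refine ⟨⟨(p.mapLe innerGraph_le).toSubgraph, v, p.mapLe innerGraph_le, hp.mapLe _, ?_, rfl⟩, ?_⟩
  · intro w hw hw2
    rw [Walk.support_mapLe_eq_support] at hw
    obtain ⟨x, hx⟩ := Set.nonempty_of_ncard_ne_zero
      (s := p.toSubgraph.neighborSet w) (by rw [hp.ncard_neighborSet_toSubgraph_eq_two hw]; norm_num)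
    exact (p.toSubgraph.adj_sub hx).2.1 hw2
  · rw [Walk.mem_verts_toSubgraph]
    exact Walk.start_mem_support _

theorem BasicCycle.degree_ne (C : BasicCycle H) {v : V} (hv : v ∈ C.1.verts) :
    H.degree v ≠ 2 := by
  obtain ⟨C, u, c, hc, hs, rfl⟩ := C
  exact hs v (by simpa using hv)

theorem InClassH.degree_of_mem (hH : InClassH H) (C : BasicCycle H) {v : V} (hv : v ∈ C.1.verts) :
    H.degree v = 3 :=
  (hH.degree_eq v).resolve_left (C.degree_ne hv)

theorem InClassH.basicCycle_adj (hH : InClassH H) (C : BasicCycle H) {v w : V}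
    (hv : v ∈ C.1.verts) (h : H.Adj v w) (hw : H.degree w ≠ 2) : C.1.Adj v w := by
  have hv3 := hH.degree_of_mem C hv
  have hsub : C.1.neighborSet v ⊆ (innerGraph H).neighborSet v := fun x hx =>
    ⟨C.1.adj_sub hx, C.degree_ne hv, C.degree_ne (C.1.edge_vert hx.symm)⟩
  have hcard : (C.1.neighborSet v).ncard = 2 := by
    obtain ⟨C, u, c, hc, hs, rfl⟩ := C
    exact hc.ncard_neighborSet_toSubgraph_eq_two (by simpa using hv)
  have heq := Set.eq_of_subset_of_ncard_le hsub
    (by rw [hcard, hH.ncard_innerGraph hv3]) (Set.toFinite _)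
  have : w ∈ (innerGraph H).neighborSet v := ⟨h, C.degree_ne hv, hw⟩
  rwa [← heq] at this

theorem BasicCycle.connected (C : BasicCycle H) : C.1.Connected := by
  obtain ⟨C, u, c, hc, hs, rfl⟩ := C
  exact c.toSubgraph_connected

/-- A set of vertices that meets a basic cycle and is closed under adjacency in that cycle
contains all its vertices. -/
theorem BasicCycle.induction (C : BasicCycle H) {P : V → Prop} {v : V} (hv : v ∈ C.1.verts)
    (hPv : P v) (hP : ∀ x y, P x → C.1.Adj x y → P y) {w : V} (hw : w ∈ C.1.verts) : P w := by
  obtain ⟨p⟩ := C.connected.coe.preconnected ⟨v, hv⟩ ⟨w, hw⟩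
  have : ∀ (x y : C.1.verts) (p : C.1.coe.Walk x y), P x → P y := by
    intro x y p
    induction p with
    | nil => exact id
    | cons h p ih => exact fun hx => ih (hP _ _ hx h)
  exact this _ _ p hPv

theorem InClassH.basicCycle_eq (hH : InClassH H) {C D : BasicCycle H} {v : V}
    (hC : v ∈ C.1.verts) (hD : v ∈ D.1.verts) : C = D := by
  have key : ∀ C D : BasicCycle H, v ∈ C.1.verts → v ∈ D.1.verts → C.1 ≤ D.1 := by
    intro C D hC hD
    have hv : C.1.verts ⊆ D.1.verts := fun w hw =>
      C.induction (P := (· ∈ D.1.verts)) hC hD (fun x y hx hxy =>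
        D.1.edge_vert (hH.basicCycle_adj D hx (C.1.adj_sub hxy)
          (C.degree_ne (C.1.edge_vert hxy.symm))).symm) hw
    exact ⟨hv, fun x y hxy => hH.basicCycle_adj D (hv (C.1.edge_vert hxy)) (C.1.adj_sub hxy)
      (C.degree_ne (C.1.edge_vert hxy.symm))⟩
  exact Subtype.ext (le_antisymm (key C D hC hD) (key D C hD hC))

/-- Otherwise every walk of `H` could be rerouted around the edges of `C`, which would not be
separating. -/
theorem InClassH.exists_adj_not_reachable (hH : InClassH H) (C : BasicCycle H) :
    ∃ x y, C.1.Adj x y ∧ ¬ (H.deleteEdges C.1.edgeSet).Reachable x y := by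
  by_contra! hcon
  have hstep : ∀ x y, H.Adj x y → (H.deleteEdges C.1.edgeSet).Reachable x y := by
    intro x y hxy
    by_cases h : C.1.Adj x y
    · exact hcon x y h
    · exact Adj.reachable (by rw [deleteEdges_adj]; exact ⟨hxy, h⟩)
  have hconn : (H.deleteEdges C.1.edgeSet).Connected := by
    have := hH.sepCycle.connected.nonempty
    refine ⟨fun x y => ?_⟩
    obtain ⟨p⟩ := hH.sepCycle.connected.preconnected x y
    induction p with
    | nil => exact Reachable.refl _
    | cons h p ih => exact (hstep _ _ h).trans ih
  obtain ⟨C, u, c, hc, hs, rfl⟩ := C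
  refine hH.sepCycle.separating u c hc ?_
  convert hconn using 2
  ext e
  simp

/-! ### Ends of an even subgraph in a basic cycle -/

variable (H) in
/-- A vertex is an end of `Z` if some edge of `Z` joins it to a vertex of degree two in `H`. -/
def IsEnd (Z : SimpleGraph V) (x : V) : Prop := ∃ y, Z.Adj x y ∧ H.degree y = 2

/-- Outside `C`, the only possible edge of `Z` at `v` goes to its unique neighbour of degree two, so
this degree is 0 or 1. -/
theorem InClassH.odd_degree_sdiff (hH : InClassH H) {Z : SimpleGraph V} (hZH : Z ≤ H)
    (C : BasicCycle H) [DecidableRel (Z \ C.1.spanningCoe).Adj] {v : V} (hv : v ∈ C.1.verts) :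
    Odd ((Z \ C.1.spanningCoe).degree v) ↔ IsEnd H Z v := by
  obtain ⟨w, hw, hun⟩ := hH.existsUnique (hH.degree_of_mem C hv)
  have hadj : ∀ y, (Z \ C.1.spanningCoe).Adj v y ↔ Z.Adj v y ∧ H.degree y = 2 := by
    intro y
    rw [sdiff_adj, Subgraph.spanningCoe_adj]
    refine and_congr_right fun h => ⟨fun hn => ?_, fun hy hn => ?_⟩
    · by_contra hy
      exact hn (hH.basicCycle_adj C hv (hZH h) hy)
    · exact C.degree_ne (C.1.edge_vert hn.symm) hy
  constructor
  · intro h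
    obtain ⟨y, hy⟩ := (degree_pos_iff_exists_adj _ _).mp h.pos
    exact ⟨y, (hadj y).mp hy⟩
  · rintro ⟨y, hy⟩
    have : (Z \ C.1.spanningCoe).degree v = 1 := by
      rw [degree_eq_one_iff_existsUnique_adj]
      refine ⟨y, (hadj y).mpr hy, fun z hz => ?_⟩
      have hz' := (hadj z).mp hz
      rw [hun z ⟨hZH hz'.1, hz'.2⟩, hun y ⟨hZH hy.1, hy.2⟩]
    simp [this]

/-- Degrees in `Z` are even, so the ends in `C` are exactly the vertices of odd degree in `Z ⊓ C`.
-/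
theorem InClassH.even_card_ends (hH : InClassH H) {Z : SimpleGraph V} (hZH : Z ≤ H)
    (hZ : Z.IsCycles) (C : BasicCycle H) (E : Finset V)
    (hE : ∀ x, x ∈ E ↔ x ∈ C.1.verts ∧ IsEnd H Z x) : Even E.card := by
  classical
  convert (Z ⊓ C.1.spanningCoe).even_card_odd_degree_vertices
  ext v
  rw [hE, Finset.mem_filter_univ]
  by_cases hv : v ∈ C.1.verts
  · have h1 := hH.odd_degree_sdiff hZH C hv
    have h2 := Z.degree_inf_add_degree_sdiff C.1.spanningCoe v
    have h3 := hZ.even_degree v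
    rw [← h2, Nat.even_add'] at h3
    rw [h3, h1]
    exact and_iff_right hv
  · have : (Z ⊓ C.1.spanningCoe).degree v = 0 := by
      rw [← Nat.le_zero, ← not_lt, degree_pos_iff_exists_adj]
      rintro ⟨w, -, hw⟩
      exact hv (C.1.edge_vert hw)
    simp [hv, this]

/-- In `Z \ C` the vertices of odd degree are the ends in `C`; the component of `a` must contain a
second one, which can only be `b`. -/
theorem InClassH.reachable_of_ends (hH : InClassH H) {Z : SimpleGraph V} (hZH : Z ≤ H)
    (hZ : Z.IsCycles) (C : BasicCycle H) {a b : V} (ha : a ∈ C.1.verts)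
    (hE : ∀ x ∈ C.1.verts, IsEnd H Z x ↔ x = a ∨ x = b) :
    (H.deleteEdges C.1.edgeSet).Reachable a b := by
  classical
  obtain ⟨w, hwa, hr, hw⟩ := (Z \ C.1.spanningCoe).exists_reachable_odd_degree (v := a)
    ((hH.odd_degree_sdiff hZH C ha).mpr ((hE a ha).mpr (Or.inl rfl)))
  have hwC : w ∈ C.1.verts := by
    by_contra hwC
    have h0 : (Z ⊓ C.1.spanningCoe).degree w = 0 := by
      rw [← Nat.le_zero, ← not_lt, degree_pos_iff_exists_adj]
      rintro ⟨x, -, hx⟩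
      exact hwC (C.1.edge_vert hx)
    have h2 := Z.degree_inf_add_degree_sdiff C.1.spanningCoe w
    rw [h0, zero_add] at h2
    rw [h2] at hw
    exact (Nat.not_even_iff_odd.mpr hw) (hZ.even_degree w)
  have hwb : w = b := ((hE w hwC).mp ((hH.odd_degree_sdiff hZH C hwC).mp hw)).resolve_left hwa
  subst hwb
  refine hr.mono fun x y h => ?_
  rw [sdiff_adj] at h
  rw [deleteEdges_adj]
  exact ⟨hZH h.1, h.2⟩

/-- At most half of the ends of `Z` in a basic cycle belong to a pair of vertices that is separated
by the deletion of the edges of that cycle. -/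
theorem InClassH.two_mul_card_ends_le (hH : InClassH H) {Z : SimpleGraph V} (hZH : Z ≤ H)
    (hZ : Z.IsCycles) (C : BasicCycle H) {a b : V} (ha : a ∈ C.1.verts) (hab : a ≠ b)
    (hr : ¬ (H.deleteEdges C.1.edgeSet).Reachable a b) (E K : Finset V)
    (hE : ∀ x, x ∈ E ↔ x ∈ C.1.verts ∧ IsEnd H Z x)
    (hKE : K ⊆ E) (hK : ∀ x ∈ K, x = a ∨ x = b) : 2 * K.card ≤ E.card := by
  classical
  have hK2 : K ⊆ {a, b} := fun x hx => by simpa using hK x hx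
  have hc2 : ({a, b} : Finset V).card = 2 := Finset.card_pair hab
  have h1 := Finset.card_le_card hK2
  have h2 := Finset.card_le_card hKE
  obtain ⟨m, hm⟩ := hH.even_card_ends hZH hZ C E hE
  -- As `E.card` is even and `K.card ≤ 2`, failure of the bound forces both cardinalities to be 2.
  by_contra hlt
  have hKab := Finset.eq_of_subset_of_card_le hK2 (by omega)
  have hKeq := Finset.eq_of_subset_of_card_le hKE (by omega)
  refine hr (hH.reachable_of_ends hZH hZ C ha fun x hx => ?_)
  have := hE x
  rw [← hKeq, hKab] at this
  simp only [Finset.mem_insert, Finset.mem_singleton] at this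
  tauto

theorem adj_of_degree_two {Z : SimpleGraph V} (hZH : Z ≤ H) (hZ : Z.IsCycles) {y w x : V}
    (hy : H.degree y = 2) (hw : Z.Adj y w) (hx : H.Adj y x) : Z.Adj y x := by
  have h2 := hZ (v := y) ⟨w, hw⟩
  have hsub : Z.neighborSet y ⊆ H.neighborSet y := fun z hz => hZH hz
  have heq := Set.eq_of_subset_of_ncard_le hsub (by
    rw [h2, ← coe_neighborFinset, Set.ncard_coe_finset, card_neighborFinset_eq_degree, hy])
  have : x ∈ H.neighborSet y := hx
  rwa [← heq] at this

/-- If every vertex of degree two in `Z` has a marked neighbour, then each of them has an unmarked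
one, since at most half of the ends of `Z` are marked. -/
theorem InClassH.exists_unmarked (hH : InClassH H) {a b : BasicCycle H → V}
    (hab : ∀ C : BasicCycle H, C.1.Adj (a C) (b C))
    (hr : ∀ C : BasicCycle H, ¬ (H.deleteEdges C.1.edgeSet).Reachable (a C) (b C))
    {Z : SimpleGraph V} (hZH : Z ≤ H) (hZ : Z.IsCycles)
    (hmark : ∀ y w, H.degree y = 2 → Z.Adj y w → ∃ x, H.Adj y x ∧ ∃ C, x = a C ∨ x = b C)
    {y w : V} (hy : H.degree y = 2) (hyw : Z.Adj y w) :
    ∃ x, H.Adj y x ∧ ∀ C, x ≠ a C ∧ x ≠ b C := by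
  classical
  by_contra! hcon
  let E : Finset V := {x | IsEnd H Z x}
  let Y : Finset V := {y | H.degree y = 2 ∧ ∃ w, Z.Adj y w}
  let K : Finset V := {x | IsEnd H Z x ∧ ∃ C, x = a C ∨ x = b C}
  have hKE : K ⊆ E := fun x hx => by
    simp only [K, E, Finset.mem_filter_univ] at hx ⊢
    exact hx.1
  have hdeg : ∀ x, IsEnd H Z x → H.degree x = 3 := fun x ⟨y, hxy, hy⟩ =>
    hH.degree_eq_three hy (hZH hxy).symm
  -- the ends are counted along the basic cycles
  let bc : V → H.Subgraph := fun x =>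
    if h : ∃ C : BasicCycle H, x ∈ C.1.verts then h.choose.1 else ⊥
  have hbc : ∀ (C : BasicCycle H) x, x ∈ C.1.verts → bc x = C.1 := by
    intro C x hx
    have h : ∃ C : BasicCycle H, x ∈ C.1.verts := ⟨C, hx⟩
    simp only [bc, dif_pos h]
    rw [hH.basicCycle_eq h.choose_spec hx]
  have hmem : ∀ (C : BasicCycle H) x, IsEnd H Z x → (bc x = C.1 ↔ x ∈ C.1.verts) := by
    intro C x hx
    refine ⟨fun h => ?_, hbc C x⟩
    obtain ⟨D, hD⟩ := hH.exists_basicCycle (hdeg x hx)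
    rw [← h, hbc D x hD]
    exact hD
  have hle : 2 * K.card ≤ E.card := by
    rw [Finset.card_eq_sum_card_fiberwise (f := bc) (t := E.image bc)
        (fun x hx => Finset.mem_image_of_mem _ (hKE hx)),
      Finset.card_eq_sum_card_fiberwise (f := bc) (s := E) (t := E.image bc)
        (fun x hx => Finset.mem_image_of_mem _ hx), Finset.mul_sum]
    refine Finset.sum_le_sum fun B hB => ?_
    obtain ⟨x0, hx0, rfl⟩ := Finset.mem_image.mp hB
    obtain ⟨C, hC⟩ := hH.exists_basicCycle (hdeg x0 (by simpa [E] using hx0))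
    rw [hbc C x0 hC]
    refine hH.two_mul_card_ends_le hZH hZ C (C.1.edge_vert (hab C)) (hab C).ne (hr C) _ _ ?_
      (Finset.filter_subset_filter _ hKE) ?_
    · intro x
      simp only [E, Finset.mem_filter, Finset.mem_univ, true_and]
      refine ⟨fun h => ⟨(hmem C x h.1).mp h.2, h.1⟩, fun h => ⟨h.2, hbc C x h.1⟩⟩
    · intro x hx
      simp only [K, Finset.mem_filter, Finset.mem_univ, true_and] at hx
      obtain ⟨⟨hx1, D, hD⟩, hx2⟩ := hx
      have hxC := (hmem C x hx1).mp hx2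
      have hxD : x ∈ D.1.verts := by
        rcases hD with rfl | rfl
        · exact D.1.edge_vert (hab D)
        · exact D.1.edge_vert (hab D).symm
      rwa [hH.basicCycle_eq hxC hxD]
  -- and along the vertices of degree two
  have hnb : ∀ x, ∃ z, IsEnd H Z x → Z.Adj x z ∧ H.degree z = 2 := fun x => by
    by_cases hx : IsEnd H Z x
    · obtain ⟨z, hz⟩ := hx
      exact ⟨z, fun _ => hz⟩
    · exact ⟨x, fun h => absurd h hx⟩
  choose n hn using hnb
  have hnY : ∀ x, IsEnd H Z x → n x ∈ Y := fun x hx => by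
    simp only [Y, Finset.mem_filter_univ]
    exact ⟨(hn x hx).2, x, (hn x hx).1.symm⟩
  have hend : ∀ z ∈ Y, ∀ x, H.Adj z x → IsEnd H Z x ∧ n x = z := by
    intro z hz x hzx
    simp only [Y, Finset.mem_filter_univ] at hz
    obtain ⟨hz2, t, hzt⟩ := hz
    have hx : IsEnd H Z x := ⟨z, (adj_of_degree_two hZH hZ hz2 hzt hzx).symm, hz2⟩
    exact ⟨hx, (hH.existsUnique (hdeg x hx)).unique ⟨hZH (hn x hx).1, (hn x hx).2⟩
      ⟨hzx.symm, hz2⟩⟩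
  have hE : E.card = ∑ z ∈ Y, 2 := by
    rw [Finset.card_eq_sum_card_fiberwise (f := n) (s := E) (t := Y)
      (fun x hx => hnY x (by simpa [E] using hx))]
    refine Finset.sum_congr rfl fun z hz => ?_
    have hz2 : H.degree z = 2 := by
      simp only [Y, Finset.mem_filter_univ] at hz
      exact hz.1
    rw [← hz2, ← card_neighborFinset_eq_degree]
    congr 1
    ext x
    simp only [E, Finset.mem_filter, Finset.mem_univ, true_and, mem_neighborFinset]
    refine ⟨?_, hend z hz x⟩
    rintro ⟨hx, rfl⟩
    exact (hZH (hn x hx).1).symm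
  have hyY : y ∈ Y := by
    simp only [Y, Finset.mem_filter_univ]
    exact ⟨hy, w, hyw⟩
  -- Each vertex of `Y` accounts for at least one marked end, and `y` for two, against `2 * K.card ≤
  -- E.card = 2 * Y.card`.
  have hlt : ∑ z ∈ Y, 1 < K.card := by
    rw [Finset.card_eq_sum_card_fiberwise (f := n) (s := K) (t := Y)
      (fun x hx => hnY x (by simpa [E] using hKE hx))]
    have hfib : ∀ z ∈ Y, ∀ x, H.Adj z x → (∃ C, x = a C ∨ x = b C) →
        x ∈ {x ∈ K | n x = z} := by
      intro z hz x hzx hx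
      simp only [K, Finset.mem_filter, Finset.mem_univ, true_and]
      exact ⟨⟨(hend z hz x hzx).1, hx⟩, (hend z hz x hzx).2⟩
    refine Finset.sum_lt_sum (fun z hz => ?_) ⟨y, hyY, ?_⟩
    · have hz' := hz
      simp only [Y, Finset.mem_filter_univ] at hz'
      obtain ⟨hz2, t, hzt⟩ := hz'
      obtain ⟨x, hzx, hx⟩ := hmark z t hz2 hzt
      exact Finset.card_pos.mpr ⟨x, hfib z hz x hzx hx⟩
    · have : H.neighborFinset y ⊆ {x ∈ K | n x = y} := fun x hx => by
        rw [mem_neighborFinset] at hx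
        refine hfib y hyY x hx ?_
        obtain ⟨C, hC⟩ := hcon x hx
        exact ⟨C, or_iff_not_imp_left.mpr hC⟩
      have := Finset.card_le_card this
      rw [card_neighborFinset_eq_degree, hy] at this
      omega
  simp only [Finset.sum_const, smul_eq_mul] at hE hlt
  omega

/-! ### Excluding connectors from a cycle of the forest part -/

theorem InClassH.exists_ne_end (hH : InClassH H) {Z : SimpleGraph V} (hZH : Z ≤ H)
    (hZ : Z.IsCycles) (C : BasicCycle H) {x : V} (hx : x ∈ C.1.verts) (hxe : IsEnd H Z x) :
    ∃ x' ∈ C.1.verts, IsEnd H Z x' ∧ x' ≠ x := by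
  classical
  let E : Finset V := {x | x ∈ C.1.verts ∧ IsEnd H Z x}
  have hev := hH.even_card_ends hZH hZ C E (fun x => by simp [E])
  have hxE : x ∈ E := by simp [E, hx, hxe]
  have hpos := Finset.card_pos.mpr ⟨x, hxE⟩
  obtain ⟨m, hm⟩ := hev
  obtain ⟨x', hx', hne⟩ := Finset.exists_mem_ne (s := E) (by omega) x
  simp only [E, Finset.mem_filter_univ] at hx'
  exact ⟨x', hx'.1, hx'.2, hne⟩

/-- At a leaf `C` of the graph of connectors on `Z`, parity gives a second end, hence a second
connector at `C`; it must lead to the same neighbour of `C`, so it is parallel to the first. -/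
theorem IsSimpleCollection.not_adj (hH : InClassH H) {S : Set V} (hS : IsSimpleCollection H S)
    (hforest : (bcGraph H S).IsAcyclic) {Z : SimpleGraph V} (hZH : Z ≤ H) (hZ : Z.IsCycles)
    (hZS : ∀ y w, H.degree y = 2 → Z.Adj y w → y ∈ S) {y w : V} (hy : H.degree y = 2) :
    ¬ Z.Adj y w := by
  intro hyw
  have hsub : bcGraph H {y | H.degree y = 2 ∧ ∃ w, Z.Adj y w} ≤ bcGraph H S := by
    rintro C D ⟨y, ⟨hy, w, hyw⟩, hj⟩
    exact ⟨y, hZS y w hy hyw, hj⟩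
  obtain ⟨C, D, hj⟩ := hS.isConnector y (hZS y w hy hyw)
  obtain ⟨C, D, ⟨y, ⟨hy, w, hyw⟩, hj⟩, hun⟩ := (hforest.anti hsub).exists_existsUnique_adj
    (u := C) (v := D) ⟨y, ⟨hy, w, hyw⟩, hj⟩
  obtain ⟨hCD, -, x, z, hN, hx, hz⟩ := hj
  have hyx : H.Adj y x := by rw [← mem_neighborSet, hN]; simp
  have hxe : IsEnd H Z x := ⟨y, (adj_of_degree_two hZH hZ hy hyw hyx).symm, hy⟩
  obtain ⟨x', hx', ⟨y', hxy', hy'⟩, hne⟩ := hH.exists_ne_end hZH hZ C hx hxe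
  have hyy' : y ≠ y' := by
    rintro rfl
    have : x' ∈ H.neighborSet y := (hZH hxy').symm
    rw [hN] at this
    rcases this with h | h
    · exact hne h
    · rw [h] at hx'
      exact hCD (hH.basicCycle_eq hx' hz)
  have hj' : ∃ D', Joins H y' C D' := by
    obtain ⟨C₁, D₁, hj₁⟩ := hS.isConnector y' (hZS y' x' hy' hxy'.symm)
    obtain ⟨-, -, x₁, z₁, hN₁, hx₁, hz₁⟩ := id hj₁
    have : x' ∈ H.neighborSet y' := (hZH hxy').symm
    rw [hN₁] at this
    rcases this with h | h
    · rw [h] at hx'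
      exact ⟨D₁, hH.basicCycle_eq hx' hx₁ ▸ hj₁⟩
    · rw [h] at hx'
      exact ⟨C₁, hH.basicCycle_eq hx' hz₁ ▸ hj₁.symm⟩
  obtain ⟨D', hj'⟩ := hj'
  obtain rfl := hun D' ⟨y', ⟨hy', x', hxy'.symm⟩, hj'⟩
  exact hS.not_parallel y (hZS y w hy hyw) y' (hZS y' x' hy' hxy'.symm) hyy'
    ⟨C, D', ⟨hCD, hy, x, z, hN, hx, hz⟩, hj'⟩

/-- If `Z` avoids the vertices of degree two, it contains each basic cycle that it meets. -/
theorem InClassH.adj_of_forall_not_adj (hH : InClassH H) {Z : SimpleGraph V} (hZH : Z ≤ H)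
    (hZ : Z.IsCycles) (h2 : ∀ y w, H.degree y = 2 → ¬ Z.Adj y w) {v w : V} (hvw : Z.Adj v w) :
    ∃ C : BasicCycle H, ∀ x y, C.1.Adj x y → Z.Adj x y := by
  have hstep : ∀ x t y, Z.Adj x t → (innerGraph H).Adj x y → Z.Adj x y := by
    intro x t y hxt hxy
    have hsub : Z.neighborSet x ⊆ (innerGraph H).neighborSet x := fun z hz =>
      ⟨hZH hz, hxy.2.1, fun h => h2 z x h hz.symm⟩
    have heq := Set.eq_of_subset_of_ncard_le hsub
      (by rw [hZ (v := x) ⟨t, hxt⟩, hH.isCycles_innerGraph (v := x) ⟨y, hxy⟩])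
    have : y ∈ (innerGraph H).neighborSet x := hxy
    rwa [← heq] at this
  have hv := (hH.degree_eq v).resolve_left fun h => h2 v w h hvw
  obtain ⟨C, hC⟩ := hH.exists_basicCycle hv
  have hin : ∀ x y, C.1.Adj x y → (innerGraph H).Adj x y := fun x y h =>
    ⟨C.1.adj_sub h, C.degree_ne (C.1.edge_vert h), C.degree_ne (C.1.edge_vert h.symm)⟩
  refine ⟨C, fun x y hxy => ?_⟩
  obtain ⟨t, ht⟩ := C.induction (P := fun x => ∃ t, Z.Adj x t) hC ⟨w, hvw⟩
    (fun x y ⟨t, ht⟩ hxy => ⟨x, (hstep x t y ht (hin x y hxy)).symm⟩) (C.1.edge_vert hxy)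
  exact hstep x t y ht (hin x y hxy)

end TwoDecomposition

/-! ### Construction of the decomposition -/

theorem proposition2p2 {V : Type*} [Fintype V] (H : SimpleGraph V) [DecidableRel H.Adj]
    (hH : TwoDecomposition.InClassH H) (S : Set V)
    (hS : TwoDecomposition.IsSimpleCollection H S)
    (hforest : (TwoDecomposition.bcGraph H S).IsAcyclic) :
    ∃ F M : H.Subgraph, TwoDecomposition.IsTwoDecomposition F M ∧
      (∀ C : H.Subgraph, TwoDecomposition.IsBasicCycle H C →
        (M.edgeSet ∩ C.edgeSet).ncard = 1) ∧
      (∀ y ∈ S, TwoDecomposition.IsFull F y ∨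
        ∃ w, H.Adj y w ∧ TwoDecomposition.IsFull F w) := by
  classical
  choose a b hab hr using fun C : TwoDecomposition.BasicCycle H => hH.exists_adj_not_reachable C
  obtain ⟨marked, hmarked⟩ : ∃ marked : V → Prop, ∀ x, marked x ↔ ∃ C, x = a C ∨ x = b C :=
    ⟨_, fun _ => Iff.rfl⟩
  -- `P` selects the vertices of degree two to be matched. The clause on `S` makes the neighbour not
  -- used by the matching full.
  obtain ⟨P, hP⟩ : ∃ P : V → Prop, ∀ y, P y ↔ H.degree y = 2 ∧ (∃ x, H.Adj y x ∧ ¬ marked x) ∧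
    (y ∈ S → ∀ x, H.Adj y x → ¬ marked x) := ⟨_, fun _ => Iff.rfl⟩
  have hf : ∀ y, ∃ x, P y → H.Adj y x ∧ ¬ marked x := by
    intro y
    by_cases hy : P y
    · obtain ⟨x, hx⟩ := ((hP y).mp hy).2.1
      exact ⟨x, fun _ => hx⟩
    · exact ⟨y, fun h => absurd h hy⟩
  choose f hf using hf
  have hPdeg : ∀ {y}, P y → H.degree y = 2 := fun h => ((hP _).mp h).1
  have ha : ∀ C, a C ∈ C.1.verts := fun C => C.1.edge_vert (hab C)
  have hb : ∀ C, b C ∈ C.1.verts := fun C => C.1.edge_vert (hab C).symm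
  let MAdj : V → V → Prop := fun u v =>
    (∃ C, (u = a C ∧ v = b C) ∨ (u = b C ∧ v = a C)) ∨ (P u ∧ v = f u) ∨ (P v ∧ u = f v)
  have hMsymm : ∀ u v, MAdj u v → MAdj v u := by
    rintro u v (⟨C, h⟩ | h | h)
    · exact Or.inl ⟨C, by tauto⟩
    · exact Or.inr (Or.inr h)
    · exact Or.inr (Or.inl h)
  have hMH : ∀ u v, MAdj u v → H.Adj u v := by
    rintro u v (⟨C, ⟨rfl, rfl⟩ | ⟨rfl, rfl⟩⟩ | ⟨hu, rfl⟩ | ⟨hv, rfl⟩)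
    · exact C.1.adj_sub (hab C)
    · exact (C.1.adj_sub (hab C)).symm
    · exact (hf u hu).1
    · exact (hf v hv).1.symm
  have hmem : ∀ x, marked x → H.degree x = 3 := by
    intro x hx
    obtain ⟨C, rfl | rfl⟩ := (hmarked x).mp hx
    · exact hH.degree_of_mem C (ha C)
    · exact hH.degree_of_mem C (hb C)
  have hM3 : ∀ y w, H.degree y = 2 → MAdj y w → P y ∧ w = f y := by
    rintro y w hy (⟨C, h⟩ | h | ⟨hw, rfl⟩)
    · have := hmem y ((hmarked y).mpr ⟨C, by tauto⟩)
      omega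
    · exact h
    · have := hH.degree_eq_three (hPdeg hw) (hf w hw).1
      omega
  have hM4 : ∀ x w, H.degree x = 3 → ¬ marked x → MAdj x w → P w ∧ x = f w := by
    rintro x w hx hxm (⟨C, h⟩ | h | h)
    · exact absurd ((hmarked x).mpr ⟨C, by tauto⟩) hxm
    · have := hPdeg h.1
      omega
    · exact h
  have hM5 : ∀ x w, marked x → MAdj x w → ∃ C, (x = a C ∧ w = b C) ∨ (x = b C ∧ w = a C) := by
    rintro x w hx (h | h | ⟨hw, rfl⟩)
    · exact h
    · have := hPdeg h.1
      have := hmem x hx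
      omega
    · exact absurd hx (hf w hw).2
  have hMun : ∀ x v w, MAdj x v → MAdj x w → v = w := by
    intro x v w hv hw
    rcases hH.degree_eq x with hx | hx
    · rw [(hM3 x v hx hv).2, (hM3 x w hx hw).2]
    by_cases hxm : marked x
    · obtain ⟨C, hC⟩ := hM5 x v hxm hv
      obtain ⟨D, hD⟩ := hM5 x w hxm hw
      have hxC : x ∈ C.1.verts := by
        rcases hC with ⟨rfl, -⟩ | ⟨rfl, -⟩
        exacts [ha C, hb C]
      have hxD : x ∈ D.1.verts := by
        rcases hD with ⟨rfl, -⟩ | ⟨rfl, -⟩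
        exacts [ha D, hb D]
      obtain rfl := hH.basicCycle_eq hxC hxD
      have := (hab C).ne
      grind
    · exact (hH.existsUnique hx).unique ⟨hMH x v hv, hPdeg (hM4 x v hx hxm hv).1⟩
        ⟨hMH x w hw, hPdeg (hM4 x w hx hxm hw).1⟩
  let M : H.Subgraph :=
    { verts := {u | ∃ v, MAdj u v}
      Adj := MAdj
      adj_sub := fun {u v} h => hMH u v h
      edge_vert := fun {u v} h => ⟨v, h⟩
      symm := ⟨hMsymm⟩ }
  let F : H.Subgraph :=
    { verts := Set.univ
      Adj := fun u v => H.Adj u v ∧ ¬ MAdj u v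
      adj_sub := fun {u v} h => h.1
      edge_vert := fun {u v} _ => Set.mem_univ u
      symm := ⟨fun u v h => ⟨h.1.symm, fun h' => h.2 (hMsymm v u h')⟩⟩ }
  have hFac : F.spanningCoe.IsAcyclic := by
    intro v c hc
    have hZ := hc.isCycles_spanningCoe_toSubgraph
    set Z := c.toSubgraph.spanningCoe with hZdef
    have hZF : ∀ x y, Z.Adj x y → H.Adj x y ∧ ¬ MAdj x y := fun x y h => c.toSubgraph.adj_sub h
    have hZH : Z ≤ H := fun x y h => (hZF x y h).1
    -- `Z` uses both edges at `y`, and one of them would be in `M`.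
    have hnP : ∀ y w, H.degree y = 2 → Z.Adj y w → ¬ P y := by
      intro y w hy hyw hPy
      exact (hZF y (f y) (TwoDecomposition.adj_of_degree_two hZH hZ hy hyw (hf y hPy).1)).2
        (Or.inr (Or.inl ⟨hPy, rfl⟩))
    have hmark : ∀ y w, H.degree y = 2 → Z.Adj y w →
        ∃ x, H.Adj y x ∧ ∃ C, x = a C ∨ x = b C := by
      intro y w hy hyw
      by_contra! hcon
      have hun : ∀ x, H.Adj y x → ¬ marked x := fun x hx hxm => by
        obtain ⟨C, hC⟩ := (hmarked x).mp hxm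
        have := hcon x hx C
        tauto
      exact hnP y w hy hyw ((hP y).mpr ⟨hy, ⟨w, hZH hyw, hun w (hZH hyw)⟩, fun _ => hun⟩)
    have hZS : ∀ y w, H.degree y = 2 → Z.Adj y w → y ∈ S := by
      intro y w hy hyw
      by_contra hyS
      obtain ⟨x, hyx, hx⟩ := hH.exists_unmarked hab hr hZH hZ hmark hy hyw
      refine hnP y w hy hyw ((hP y).mpr ⟨hy, ⟨x, hyx, fun hxm => ?_⟩, fun h => absurd h hyS⟩)
      obtain ⟨C, hC⟩ := (hmarked x).mp hxm
      have := hx C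
      tauto
    obtain ⟨w, hvw⟩ := Set.nonempty_of_ncard_ne_zero (s := c.toSubgraph.neighborSet v)
      (by rw [hc.ncard_neighborSet_toSubgraph_eq_two c.start_mem_support]; norm_num)
    obtain ⟨C, hC⟩ := hH.adj_of_forall_not_adj hZH hZ
      (fun y w hy => hS.not_adj hH hforest hZH hZ hZS hy) (v := v) (w := w) hvw
    exact (hZF _ _ (hC _ _ (hab C))).2 (Or.inl ⟨C, Or.inl ⟨rfl, rfl⟩⟩)
  refine ⟨F, M, ⟨fun v => Set.mem_univ v, ?_, ?_, ?_, ?_⟩, ?_, ?_⟩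
  · exact hFac.comap ⟨Subtype.val, fun h => h⟩ Subtype.val_injective
  · rintro v ⟨w, hw⟩
    exact ⟨w, hw, fun t ht => hMun v t w ht hw⟩
  · rw [Set.disjoint_left]
    intro e
    induction e with
    | _ u v => exact fun h h' => h.2 h'
  · ext e
    induction e with
    | _ u v =>
      refine ⟨fun h => h.elim (fun h => h.1) (fun h => hMH u v h), fun h => ?_⟩
      by_cases hm : MAdj u v
      · exact Or.inr hm
      · exact Or.inl ⟨h, hm⟩
  · intro C hC
    rw [Set.ncard_eq_one]
    refine ⟨s(a ⟨C, hC⟩, b ⟨C, hC⟩), ?_⟩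
    ext e
    induction e with
    | _ u v =>
      rw [Set.mem_singleton_iff]
      constructor
      · rintro ⟨hm, hc⟩
        have hc : C.Adj u v := hc
        have hu := hH.degree_of_mem ⟨C, hC⟩ (C.edge_vert hc)
        have hv := hH.degree_of_mem ⟨C, hC⟩ (C.edge_vert hc.symm)
        have hm : MAdj u v := hm
        rcases hm with ⟨D, hD⟩ | h | h
        · have huD : u ∈ D.1.verts := by
            rcases hD with ⟨rfl, -⟩ | ⟨rfl, -⟩
            exacts [ha D, hb D]
          obtain rfl := hH.basicCycle_eq huD (D := ⟨C, hC⟩) (C.edge_vert hc)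
          rw [Sym2.eq_iff]
          exact hD
        · have := hPdeg h.1
          omega
        · have := hPdeg h.1
          omega
      · intro h
        rw [h]
        exact ⟨Or.inl ⟨⟨C, hC⟩, Or.inl ⟨rfl, rfl⟩⟩, hab ⟨C, hC⟩⟩
  · intro y hyS
    obtain ⟨_, _, -, hy, -⟩ := hS.isConnector y hyS
    have hy : H.degree y = 2 := hy
    by_cases hPy : P y
    · right
      obtain ⟨w, hw, hne⟩ := Finset.exists_mem_ne (s := H.neighborFinset y)
        (by rw [SimpleGraph.card_neighborFinset_eq_degree, hy]; norm_num) (f y)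
      rw [SimpleGraph.mem_neighborFinset] at hw
      -- The neighbour `w ≠ f y` is unmarked, so only its unique neighbour of degree two, `y`, could
      -- be matched to it.
      refine ⟨w, hw, fun t hwt => ⟨hwt, fun hm => ?_⟩⟩
      have hw3 := hH.degree_eq_three hy hw
      obtain ⟨ht, rfl⟩ := hM4 w t hw3 (((hP y).mp hPy).2.2 hyS w hw) hm
      rw [(hH.existsUnique hw3).unique ⟨hwt, hPdeg ht⟩ ⟨hw.symm, hy⟩] at hne
      exact hne rfl
    · left
      exact fun w hw => ⟨hw, fun hm => hPy (hM3 y w hy hm).1⟩
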